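/- A dilation matrix is a matrix $A\in M_m(\mathbb{Z})$ all of whose complex eigenvalues $\lambda$ satisfy $|\lambda|>1$. A digit set for $A$ is a set $D\subset\mathbb{Z}^m$ that contains exactly one representative of each coset in $\mathbb{Z}^m/A\mathbb{Z}^m$. The attractor $T(A,D)$ of the iterated function system $f_d(x)=A^{-1}(x+d)$, $d\in D$, is the unique nonempty compact set $T\subset\mathbb{R}^m$ with $T=\bigcup_{d\in D}f_d(T)$. Let $A$ be any dilation matrix all of whose eigenvalues are rational. Then there exists a digit set $D_A$ for $A$ such that the attractor $T(A,D_A)$ exists, is unique, and is connected. -/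

import Mathlib

/-- `μ` is a (complex) eigenvalue of the integer matrix `A`. -/
def IsEigenvalueOf {m : ℕ} (A : Matrix (Fin m) (Fin m) ℤ) (μ : ℂ) : Prop :=
  Module.End.HasEigenvalue (Matrix.toLin' (A.map (Int.cast : ℤ → ℂ))) μ

/-- A dilation matrix: an integer matrix all of whose complex eigenvalues have modulus `> 1`. -/
def IsDilationMatrix {m : ℕ} (A : Matrix (Fin m) (Fin m) ℤ) : Prop :=
  ∀ μ : ℂ, IsEigenvalueOf A μ → 1 < ‖μ‖

/-- A (basic) digit set for `A`: a complete set of coset representatives of `ℤ^m / A ℤ^m`,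
with exactly one representative from each coset. -/
def IsDigitSet {m : ℕ} (A : Matrix (Fin m) (Fin m) ℤ) (D : Set (Fin m → ℤ)) : Prop :=
  Set.BijOn (LinearMap.range A.mulVecLin).mkQ D Set.univ

/-- The map `f_d(x) = A⁻¹ (x + d)` on `ℝ^m`. -/
noncomputable def digitMap {m : ℕ} (A : Matrix (Fin m) (Fin m) ℤ) (d : Fin m → ℤ)
    (x : Fin m → ℝ) : Fin m → ℝ :=
  (A.map (Int.cast : ℤ → ℝ))⁻¹.mulVec (x + fun i => (d i : ℝ))

/-- `T` is an attractor of the iterated function system `{f_d : d ∈ D}`: a nonempty compact set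
with `T = ⋃_{d ∈ D} f_d(T)`. -/
structure IsAttractor {m : ℕ} (A : Matrix (Fin m) (Fin m) ℤ) (D : Set (Fin m → ℤ))
    (T : Set (Fin m → ℝ)) : Prop where
  nonempty : T.Nonempty
  isCompact : IsCompact T
  self_affine : T = ⋃ d ∈ D, digitMap A d '' T

/-!
Rationality of the eigenvalues makes the characteristic polynomial split over `ℤ`, so `A` is
conjugate over `ℤ` to an upper triangular matrix `M` whose diagonal entries have modulus at least
`2`. Rescaling the `i`-th basis vector by a power of a large integer coprime to `det M`, with
exponent decreasing in `i`, turns `M` into a real matrix `B` whose off-diagonal row sums are less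
than `1 / 2`. In the rescaled coordinates the digits are the integer vectors `k` with
`0 ≤ k i < |M i i|`; by coprimality their multiples by the scaling factors still form a complete
residue system modulo `M`.

By Hata's criterion the attractor `T` is connected once the pieces of digits `k` and `k + e_i`
always meet, that is, once `e_i ∈ T - T`. Now `T - T` is the attractor of the system of digit
differences, so it contains every bounded set `V` such that each `v ∈ V` has `B v - δ ∈ V` for some
difference `δ` of two digits. The vectors with entry `±1` at `i`, zeros after `i` and entries of
modulus at most `1 / 2` before `i` form such a set: subtracting the nearest integer restores the
entries before `i`, and the entry at `i` is corrected exactly.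
-/

section IteratedFunctionSystem

open Metric Set TopologicalSpace
open scoped NNReal

variable {E F α β : Type*}

/-- `T` is an attractor of the iterated function system `f d`, `d ∈ D`: a nonempty compact set that
is the union of its images under the maps of the system. -/
structure IsIFSAttractor [TopologicalSpace E] (f : α → E → E) (D : Set α) (T : Set E) : Prop where
  nonempty : T.Nonempty
  isCompact : IsCompact T
  eq_biUnion : T = ⋃ d ∈ D, f d '' T

variable {f : α → E → E} {D : Set α} {T : Set E} {K : ℝ≥0}

theorem IsIFSAttractor.mapsTo [TopologicalSpace E] (hT : IsIFSAttractor f D T) {d : α}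
    (hd : d ∈ D) : MapsTo (f d) T T := fun x hx => by
  rw [hT.eq_biUnion]
  exact mem_biUnion hd (mem_image_of_mem _ hx)

theorem IsIFSAttractor.exists_eq [TopologicalSpace E] (hT : IsIFSAttractor f D T) {x : E}
    (hx : x ∈ T) : ∃ d ∈ D, ∃ y ∈ T, f d y = x := by
  rw [hT.eq_biUnion] at hx
  simpa only [mem_iUnion, mem_image, exists_prop] using hx

theorem isIFSAttractor_image_iff [TopologicalSpace E] [TopologicalSpace F] (e : E ≃ₜ F) (φ : α → β)
    {g : β → F → F} (h : ∀ a x, g (φ a) (e x) = e (f a x)) :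
    IsIFSAttractor g (φ '' D) (e '' T) ↔ IsIFSAttractor f D T := by
  have hunion : ⋃ b ∈ φ '' D, g b '' (e '' T) = e '' ⋃ a ∈ D, f a '' T := by
    simp only [biUnion_image, image_iUnion₂, image_image, h]
  constructor
  · intro hT
    refine ⟨hT.nonempty.of_image, e.isCompact_image.1 hT.isCompact, ?_⟩
    rw [← e.injective.image_injective.eq_iff, ← hunion]
    exact hT.eq_biUnion
  · intro hT
    refine ⟨hT.nonempty.image e, e.isCompact_image.2 hT.isCompact, ?_⟩
    rw [hunion, ← hT.eq_biUnion]

theorem infEDist_image_le_of_lipschitzWith [PseudoEMetricSpace E] [PseudoEMetricSpace F]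
    {g : E → F} (hg : LipschitzWith K g) {s : Set E} (hs : s.Nonempty) (x : E) :
    infEDist (g x) (g '' s) ≤ K * infEDist x s := by
  have := hs.to_subtype
  rw [infEDist, infEDist, iInf_image, iInf_subtype', iInf_subtype',
    ENNReal.mul_iInf fun h => absurd h ENNReal.coe_ne_top]
  exact iInf_mono fun y => hg x y

theorem infDist_le_mul_infDist_of_mapsTo [PseudoMetricSpace E] {g : E → E}
    (hg : LipschitzWith K g) {s : Set E} (hs : s.Nonempty) (hmaps : MapsTo g s s) (x : E) :
    infDist (g x) s ≤ K * infDist x s := by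
  have hle : infEDist (g x) s ≤ K * infEDist x s :=
    (infEDist_anti hmaps.image_subset).trans (infEDist_image_le_of_lipschitzWith hg hs x)
  simpa only [infDist, ENNReal.toReal_mul, ENNReal.coe_toReal] using
    ENNReal.toReal_mono (ENNReal.mul_ne_top ENNReal.coe_ne_top (infEDist_ne_top hs)) hle

theorem hausdorffEDist_image_le_of_lipschitzWith [PseudoEMetricSpace E] [PseudoEMetricSpace F]
    {g : E → F} (hg : LipschitzWith K g) {s t : Set E} (hs : s.Nonempty) (ht : t.Nonempty) :
    hausdorffEDist (g '' s) (g '' t) ≤ K * hausdorffEDist s t := by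
  refine hausdorffEDist_le_of_infEDist ?_ ?_ <;> rintro _ ⟨x, hx, rfl⟩
  · exact (infEDist_image_le_of_lipschitzWith hg ht x).trans
      (by gcongr; exact infEDist_le_hausdorffEDist_of_mem hx)
  · rw [hausdorffEDist_comm]
    exact (infEDist_image_le_of_lipschitzWith hg hs x).trans
      (by gcongr; exact infEDist_le_hausdorffEDist_of_mem hx)

theorem exists_isIFSAttractor [MetricSpace E] [CompleteSpace E] [Nonempty E] (hD : D.Finite)
    (hne : D.Nonempty) (hK : K < 1) (hf : ∀ d ∈ D, LipschitzWith K (f d)) :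
    ∃ T, IsIFSAttractor f D T := by
  let hutchinson (S : NonemptyCompacts E) : NonemptyCompacts E :=
    { carrier := ⋃ d ∈ D, f d '' S
      isCompact' := hD.isCompact_biUnion fun d hd => S.isCompact.image (hf d hd).continuous
      nonempty' := hne.elim fun d hd => (S.nonempty.image (f d)).mono (subset_biUnion_of_mem hd) }
  have hcontr : ContractingWith K hutchinson := by
    refine ⟨hK, fun S S' => ?_⟩
    calc hausdorffEDist (⋃ d ∈ D, f d '' (S : Set E)) (⋃ d ∈ D, f d '' S')
        ≤ ⨆ d ∈ D, hausdorffEDist (f d '' S) (f d '' S') := by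
          exact hausdorffEDist_iUnion_le.trans (iSup_mono fun d => hausdorffEDist_iUnion_le)
      _ ≤ K * hausdorffEDist (S : Set E) S' :=
          iSup₂_le fun d hd =>
            hausdorffEDist_image_le_of_lipschitzWith (hf d hd) S.nonempty S'.nonempty
  let T := hcontr.fixedPoint
  exact ⟨T, T.nonempty, T.isCompact, congrArg SetLike.coe hcontr.fixedPoint_isFixedPt.symm⟩

theorem subset_of_subset_biUnion_image [PseudoMetricSpace E] {C S : Set E}
    (hC : Bornology.IsBounded C) (hS : IsClosed S) (hne : S.Nonempty) (hK : K < 1)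
    (hf : ∀ d ∈ D, LipschitzWith K (f d)) (hmaps : ∀ d ∈ D, MapsTo (f d) S S)
    (hcover : C ⊆ ⋃ d ∈ D, f d '' C) : C ⊆ S := by
  obtain ⟨s, hs⟩ := hne
  obtain ⟨c, hc⟩ := hC.subset_closedBall s
  have hdist : ∀ n : ℕ, ∀ x ∈ C, infDist x S ≤ K ^ n * c := by
    intro n
    induction n with
    | zero =>
      intro x hx
      simpa using (infDist_le_dist_of_mem hs).trans (mem_closedBall.1 (hc hx))
    | succ n ih =>
      intro x hx
      obtain ⟨d, hd, y, hy, rfl⟩ : ∃ d ∈ D, ∃ y ∈ C, f d y = x := by simpa using hcover hx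
      calc infDist (f d y) S ≤ K * infDist y S :=
            infDist_le_mul_infDist_of_mapsTo (hf d hd) ⟨s, hs⟩ (hmaps d hd) y
        _ ≤ K * (K ^ n * c) := by gcongr; exact ih y hy
        _ = K ^ (n + 1) * c := by ring
  intro x hx
  rw [hS.mem_iff_infDist_zero ⟨s, hs⟩]
  have hlim : Filter.Tendsto (fun n : ℕ => (K : ℝ) ^ n * c) Filter.atTop (nhds 0) := by
    simpa using (tendsto_pow_atTop_nhds_zero_of_lt_one K.2 hK).mul_const c
  exact le_antisymm (ge_of_tendsto' hlim fun n => hdist n x hx) infDist_nonneg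

theorem IsIFSAttractor.eq [MetricSpace E] {T' : Set E} (hK : K < 1)
    (hf : ∀ d ∈ D, LipschitzWith K (f d)) (hT : IsIFSAttractor f D T)
    (hT' : IsIFSAttractor f D T') : T = T' := by
  have hsub {S S' : Set E} (hS : IsIFSAttractor f D S) (hS' : IsIFSAttractor f D S') : S ⊆ S' :=
    subset_of_subset_biUnion_image hS.isCompact.isBounded hS'.isCompact.isClosed hS'.nonempty hK hf
      (fun _ => hS'.mapsTo) hS.eq_biUnion.subset
  exact (hsub hT hT').antisymm (hsub hT' hT)

-- If `φ` is locally constant at scale `K ^ (n + 1) * c`, then each `φ ∘ f d` is so at scale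
-- `K ^ n * c`, hence constant, and the chain of meeting pieces forces these constants to agree.
theorem IsIFSAttractor.eq_of_forall_dist_le [PseudoMetricSpace E] {γ : Type*}
    (hT : IsIFSAttractor f D T) (hf : ∀ d ∈ D, LipschitzWith K (f d)) {d₀ : α} (hd₀ : d₀ ∈ D)
    (hchain : ∀ d ∈ D, Relation.ReflTransGen
      (fun a b => a ∈ D ∧ b ∈ D ∧ (f a '' T ∩ f b '' T).Nonempty) d₀ d) {c : ℝ}
    (hc : ∀ x ∈ T, ∀ y ∈ T, dist x y ≤ c) (n : ℕ) {φ : E → γ}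
    (hφ : ∀ x ∈ T, ∀ y ∈ T, dist x y ≤ K ^ n * c → φ x = φ y) :
    ∀ x ∈ T, ∀ y ∈ T, φ x = φ y := by
  induction n generalizing φ with
  | zero => exact fun x hx y hy => hφ x hx y hy (by simpa using hc x hx y hy)
  | succ n ih =>
    have hpiece : ∀ d ∈ D, ∀ x ∈ T, ∀ y ∈ T, φ (f d x) = φ (f d y) := by
      intro d hd
      refine ih (φ := φ ∘ f d) fun x hx y hy hxy => hφ _ (hT.mapsTo hd hx) _ (hT.mapsTo hd hy) ?_
      calc dist (f d x) (f d y) ≤ K * dist x y := (hf d hd).dist_le_mul x y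
        _ ≤ K * (K ^ n * c) := by gcongr
        _ = K ^ (n + 1) * c := by ring
    obtain ⟨x₀, hx₀⟩ := hT.nonempty
    have hall : ∀ d ∈ D, ∀ x ∈ T, φ (f d x) = φ (f d₀ x₀) := by
      intro d hd
      induction hchain d hd with
      | refl => exact fun x hx => hpiece d₀ hd₀ x hx x₀ hx₀
      | @tail a b _ hab hconst_a =>
        obtain ⟨_, ⟨u, hu, rfl⟩, v, hv, huv⟩ := hab.2.2
        intro x hx
        rw [hpiece b hd x hx v hv, huv, hconst_a hab.1 u hu]
    intro x hx y hy
    obtain ⟨a, ha, x', hx', rfl⟩ := hT.exists_eq hx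
    obtain ⟨b, hb, y', hy', rfl⟩ := hT.exists_eq hy
    rw [hall a ha x' hx', hall b hb y' hy']

theorem IsIFSAttractor.isConnected [PseudoMetricSpace E] (hT : IsIFSAttractor f D T) (hK : K < 1)
    (hf : ∀ d ∈ D, LipschitzWith K (f d)) {d₀ : α} (hd₀ : d₀ ∈ D)
    (hchain : ∀ d ∈ D, Relation.ReflTransGen
      (fun a b => a ∈ D ∧ b ∈ D ∧ (f a '' T ∩ f b '' T).Nonempty) d₀ d) : IsConnected T := by
  refine ⟨hT.nonempty, isPreconnected_of_forall_constant fun φ hφ => ?_⟩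
  have hφ' : UniformContinuousOn φ T := hT.isCompact.uniformContinuousOn_of_continuous hφ
  obtain ⟨δ, hδ, hφδ⟩ : ∃ δ > 0, ∀ x ∈ T, ∀ y ∈ T, dist x y < δ → φ x = φ y := by
    have hBool : (uniformity Bool).HasBasis (fun _ : Unit => True) fun _ => SetRel.id := by
      rw [DiscreteUniformity.eq_principal_setRelId]
      exact Filter.hasBasis_principal _
    simpa using (Metric.uniformity_basis_dist.uniformContinuousOn_iff hBool).1 hφ'
  obtain ⟨c, hc⟩ := isBounded_iff.1 hT.isCompact.isBounded
  have hlim : Filter.Tendsto (fun n : ℕ => (K : ℝ) ^ n * c) Filter.atTop (nhds 0) := by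
    simpa using (tendsto_pow_atTop_nhds_zero_of_lt_one K.2 hK).mul_const c
  obtain ⟨n, hn⟩ := (hlim.eventually (gt_mem_nhds hδ)).exists
  exact hT.eq_of_forall_dist_le hf hd₀ hchain (fun x hx y hy => hc hx hy) n
    fun x hx y hy hxy => hφδ x hx y hy (hxy.trans_lt hn)

end IteratedFunctionSystem

section SelfAffineSystem

open Set
open scoped NNReal Pointwise

variable {E F α : Type*}

theorem image_inter_image_nonempty_of_sub_mem_sub [AddCommGroup E] (L : E → F) {S : Set E}
    {u w : E} (h : w - u ∈ S - S) :
    ((fun x => L (x + u)) '' S ∩ (fun x => L (x + w)) '' S).Nonempty := by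
  obtain ⟨x, hx, y, hy, hxy⟩ := h
  have hxy : x + u = y + w := (sub_eq_sub_iff_add_eq_add.1 hxy).trans (add_comm w y)
  exact ⟨L (x + u), mem_image_of_mem _ hx, y, hy, congrArg L hxy.symm⟩

theorem IsIFSAttractor.subset_sub [NormedAddCommGroup E] {L : E →+ E} {v : α → E} {D : Set α}
    {T V : Set E} {K : ℝ≥0} (hT : IsIFSAttractor (fun a x => L (x + v a)) D T)
    (hL : LipschitzWith K L) (hK : K < 1) (hV : Bornology.IsBounded V)
    (hcover : ∀ x ∈ V, ∃ y ∈ V, ∃ a ∈ D, ∃ b ∈ D, L (y + (v a - v b)) = x) : V ⊆ T - T := by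
  have hclosed : IsClosed (T - T) := by
    rw [← sub_image_prod]
    exact ((hT.isCompact.prod hT.isCompact).image continuous_sub).isClosed
  refine subset_of_subset_biUnion_image (f := fun (p : α × α) y => L (y + (v p.1 - v p.2)))
    (D := D ×ˢ D) hV hclosed (hT.nonempty.sub hT.nonempty) hK (fun p _ => ?_) ?_ fun x hx => ?_
  · simpa only [mul_one] using! hL.comp ((isometry_add_right (v p.1 - v p.2)).lipschitz)
  · rintro ⟨a, b⟩ ⟨ha, hb⟩ _ ⟨x, hx, y, hy, rfl⟩
    refine ⟨_, hT.mapsTo ha hx, _, hT.mapsTo hb hy, ?_⟩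
    simp only [← map_sub]
    congr 1
    abel
  · obtain ⟨y, hy, a, ha, b, hb, rfl⟩ := hcover x hx
    exact mem_biUnion (x := (a, b)) ⟨ha, hb⟩ (mem_image_of_mem _ hy)

end SelfAffineSystem

section MatrixEstimates

open Matrix Finset

variable {ι 𝕜 : Type*} [Fintype ι]

theorem mulVec_apply_of_isUpperTriangular [NonUnitalNonAssocSemiring 𝕜] [LinearOrder ι]
    {M : Matrix ι ι 𝕜} (hM : M.IsUpperTriangular) {x : ι → 𝕜} {i : ι}
    (hx : ∀ j, i < j → x j = 0) : (M *ᵥ x) i = M i i * x i := by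
  rw [mulVec, dotProduct]
  refine sum_eq_single i (fun j _ hj => ?_) fun h => absurd (mem_univ i) h
  rcases hj.lt_or_gt with hji | hij
  · rw [hM hji, zero_mul]
  · rw [hx j hij, mul_zero]

variable [NormedField 𝕜] [DecidableEq ι]

theorem norm_mulVec_apply_sub_le (M : Matrix ι ι 𝕜) (x : ι → 𝕜) (i : ι) :
    ‖(M *ᵥ x) i - M i i * x i‖ ≤ (∑ j ∈ univ.erase i, ‖M i j‖) * ‖x‖ := by
  have hsplit : (M *ᵥ x) i - M i i * x i = ∑ j ∈ univ.erase i, M i j * x j :=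
    sub_eq_of_eq_add' (add_sum_erase _ (fun j => M i j * x j) (mem_univ i)).symm
  rw [hsplit, Finset.sum_mul]
  refine norm_sum_le_of_le _ fun j _ => ?_
  rw [norm_mul]
  gcongr
  exact norm_le_pi_norm x j

theorem mul_norm_le_norm_mulVec {M : Matrix ι ι 𝕜} {a : ℝ}
    (hM : ∀ i, a + ∑ j ∈ univ.erase i, ‖M i j‖ ≤ ‖M i i‖) (x : ι → 𝕜) :
    a * ‖x‖ ≤ ‖M *ᵥ x‖ := by
  cases isEmpty_or_nonempty ι
  · simp [Subsingleton.elim x 0]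
  obtain ⟨i, hi⟩ := Finite.exists_max fun j => ‖x j‖
  have hxi : ‖x‖ = ‖x i‖ :=
    ((pi_norm_le_iff_of_nonneg (norm_nonneg _)).2 hi).antisymm (norm_le_pi_norm x i)
  have hrow := norm_mulVec_apply_sub_le M x i
  have htri := norm_sub_norm_le (M i i * x i) ((M *ᵥ x) i)
  rw [norm_mul, norm_sub_rev, ← hxi] at htri
  have := mul_le_mul_of_nonneg_right (hM i) (norm_nonneg x)
  linarith [norm_le_pi_norm (M *ᵥ x) i]

end MatrixEstimates

section NearDiagonal

open Matrix Finset
open scoped NNReal Pointwise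

theorem exists_eq_add_single_of_covBy {ι : Type*} [DecidableEq ι] {k l : ι → ℤ} (h : k ⋖ l) :
    ∃ i, l = k + Pi.single i 1 := by
  obtain ⟨i, hi⟩ : ∃ i, k i < l i := by
    by_contra! hlk
    exact h.lt.not_ge hlk
  refine ⟨i, ((h.eq_or_eq (le_add_of_nonneg_right ?_) fun j => ?_).resolve_left ?_).symm⟩
  · exact Pi.single_nonneg.2 zero_le_one
  · rcases eq_or_ne j i with rfl | hj
    · simpa using hi
    · simpa [hj] using h.le j
  · simp

theorem exists_int_abs_le_abs_sub_eq_one {n : ℤ} (hn : n ≠ 0) :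
    ∃ δ : ℤ, |δ| ≤ |n| - 1 ∧ |n - δ| = 1 := by
  refine ⟨n - n.sign, ?_, ?_⟩
  · rcases hn.lt_or_gt with h | h
    · rw [Int.sign_eq_neg_one_of_neg h, abs_of_neg h, abs_le]; lia
    · rw [Int.sign_eq_one_of_pos h, abs_of_pos h, abs_le]; lia
  · rw [sub_sub_cancel, Int.abs_sign_of_ne_zero hn]

theorem abs_round_le_sub_one {n : ℤ} {y : ℝ} (hy : |y| < n - 1 / 2) : |round y| ≤ n - 1 := by
  have hround := abs_sub_round y
  have : |(round y : ℝ)| < n := by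
    linarith [abs_sub_abs_le_abs_sub (round y : ℝ) y, abs_sub_comm y (round y)]
  have : |round y| < n := by exact_mod_cast this
  lia

/-- The maps `x ↦ B⁻¹ (x + k)` for integer vectors `k`: the system of `digitMap` for a real matrix
`B` and an arbitrary index type. -/
noncomputable def translateInvMap {ι : Type*} [Fintype ι] [DecidableEq ι] (B : Matrix ι ι ℝ)
    (k : ι → ℤ) (x : ι → ℝ) : ι → ℝ :=
  B⁻¹ *ᵥ (x + fun i => (k i : ℝ))

/-- The box of integer vectors `k` with `0 ≤ k i < |c i|`. -/
def digitBox {ι : Type*} (c : ι → ℤ) : Set (ι → ℤ) :=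
  Set.Icc 0 fun i => |c i| - 1

theorem exists_mem_digitBox_sub_eq {ι : Type*} {c δ : ι → ℤ} (hδ : ∀ i, |δ i| ≤ |c i| - 1) :
    ∃ k ∈ digitBox c, ∃ l ∈ digitBox c, k - l = δ :=
  ⟨δ⁺, ⟨posPart_nonneg δ, fun i => (sup_le (le_abs_self _) (abs_nonneg _)).trans (hδ i)⟩,
    δ⁻, ⟨negPart_nonneg δ, fun i => (sup_le (neg_le_abs _) (abs_nonneg _)).trans (hδ i)⟩,
    posPart_sub_negPart δ⟩

/-- `v` has entry `±1` at `i`, zeros after `i`, and entries of modulus at most `1 / 2` before `i`.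
These vectors contain `e_i` and reproduce themselves under `v ↦ B v - δ` with integer `δ`. -/
structure IsPivotVector {ι : Type*} [Preorder ι] (i : ι) (v : ι → ℝ) : Prop where
  abs_eq_one : |v i| = 1
  abs_le_half (j : ι) (hj : j < i) : |v j| ≤ 1 / 2
  eq_zero (j : ι) (hj : i < j) : v j = 0

theorem isPivotVector_single {ι : Type*} [LinearOrder ι] (i : ι) :
    IsPivotVector i (Pi.single i (1 : ℝ)) where
  abs_eq_one := by simp
  abs_le_half j hj := by simp [hj.ne]
  eq_zero j hj := by simp [hj.ne']

variable {ι : Type*} [Fintype ι] [LinearOrder ι] {B : Matrix ι ι ℝ} {c : ι → ℤ}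

/-- `B` is upper triangular with integer diagonal entries `c i` of modulus at least `2` and
off-diagonal row sums less than `1 / 2`. -/
structure IsNearDiagonal (B : Matrix ι ι ℝ) (c : ι → ℤ) : Prop where
  isUpperTriangular : B.IsUpperTriangular
  diag_eq (i : ι) : B i i = c i
  two_le_abs (i : ι) : 2 ≤ |c i|
  sum_offDiag_lt (i : ι) : ∑ j ∈ univ.erase i, ‖B i j‖ < 1 / 2

theorem IsPivotVector.norm_le_one {i : ι} {v : ι → ℝ} (hv : IsPivotVector i v) : ‖v‖ ≤ 1 := by
  refine (pi_norm_le_iff_of_nonneg zero_le_one).2 fun j => ?_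
  rw [Real.norm_eq_abs]
  rcases lt_trichotomy j i with hj | rfl | hj
  · linarith [hv.abs_le_half j hj]
  · exact hv.abs_eq_one.le
  · simp [hv.eq_zero j hj]

namespace IsNearDiagonal

theorem isUnit_det (hB : IsNearDiagonal B c) : IsUnit B.det := by
  refine (det_ne_zero_of_sum_row_lt_diag fun i => ?_).isUnit
  have : (2 : ℝ) ≤ |(c i : ℝ)| := by exact_mod_cast hB.two_le_abs i
  rw [hB.diag_eq, Real.norm_eq_abs]
  linarith [hB.sum_offDiag_lt i]

theorem zero_mem_digitBox (hB : IsNearDiagonal B c) : 0 ∈ digitBox c :=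
  ⟨le_rfl, fun i => sub_nonneg.2 (one_le_two.trans (hB.two_le_abs i))⟩

theorem lipschitzWith_inv_mulVec (hB : IsNearDiagonal B c) :
    LipschitzWith (2 / 3) fun x => B⁻¹ *ᵥ x := by
  refine LipschitzWith.of_dist_le_mul fun x y => ?_
  have hexpand := mul_norm_le_norm_mulVec (M := B) (a := 3 / 2) (fun i => ?_) (B⁻¹ *ᵥ (x - y))
  · rw [mulVec_mulVec, mul_nonsing_inv _ hB.isUnit_det, one_mulVec] at hexpand
    rw [dist_eq_norm, dist_eq_norm, ← mulVec_sub]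
    push_cast
    linarith
  · have : (2 : ℝ) ≤ |(c i : ℝ)| := by exact_mod_cast hB.two_le_abs i
    rw [hB.diag_eq, Real.norm_eq_abs]
    linarith [hB.sum_offDiag_lt i]

theorem lipschitzWith_translateInvMap (hB : IsNearDiagonal B c) (k : ι → ℤ) :
    LipschitzWith (2 / 3) (translateInvMap B k) := by
  simpa only [mul_one] using!
    hB.lipschitzWith_inv_mulVec.comp (isometry_add_right fun i => (k i : ℝ)).lipschitz

theorem abs_mulVec_apply_lt (hB : IsNearDiagonal B c) {v : ι → ℝ} (hv : ‖v‖ ≤ 1) {j : ι}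
    (hj : |v j| ≤ 1 / 2) : |(B *ᵥ v) j| < |c j| - 1 / 2 := by
  have hrow : |(B *ᵥ v) j - c j * v j| < 1 / 2 := by
    rw [← hB.diag_eq, ← Real.norm_eq_abs]
    calc _ ≤ (∑ l ∈ univ.erase j, ‖B j l‖) * ‖v‖ := norm_mulVec_apply_sub_le B v j
      _ ≤ ∑ l ∈ univ.erase j, ‖B j l‖ := mul_le_of_le_one_right (by positivity) hv
      _ < 1 / 2 := hB.sum_offDiag_lt j
  have hc : (2 : ℝ) ≤ |(c j : ℝ)| := by exact_mod_cast hB.two_le_abs j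
  have hdiag : |c j * v j| ≤ |(c j : ℝ)| * (1 / 2) := by rw [abs_mul]; gcongr
  push_cast
  linarith [abs_sub_abs_le_abs_sub ((B *ᵥ v) j) (c j * v j)]

theorem exists_isPivotVector_sub (hB : IsNearDiagonal B c) {i : ι} {v : ι → ℝ}
    (hv : IsPivotVector i v) : ∃ δ : ι → ℤ, (∀ j, |δ j| ≤ |c j| - 1) ∧
      IsPivotVector i (B *ᵥ v - fun j => (δ j : ℝ)) := by
  suffices h : ∀ j, ∃ δ : ℤ, |δ| ≤ |c j| - 1 ∧ (j < i → |(B *ᵥ v) j - δ| ≤ 1 / 2) ∧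
      (j = i → |(B *ᵥ v) j - δ| = 1) ∧ (i < j → (B *ᵥ v) j - δ = 0) by
    choose δ hδ hlt heq hgt using h
    exact ⟨δ, hδ, heq i rfl, hlt, hgt⟩
  intro j
  rcases lt_trichotomy j i with hj | rfl | hj
  · refine ⟨round ((B *ᵥ v) j), abs_round_le_sub_one ?_, fun _ => abs_sub_round _,
      fun h => absurd h hj.ne, fun h => absurd h hj.asymm⟩
    exact_mod_cast hB.abs_mulVec_apply_lt hv.norm_le_one (hv.abs_le_half j hj)
  · obtain ⟨σ, hσ, hvσ⟩ : ∃ σ : ℤ, |σ| = 1 ∧ v j = σ := by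
      rcases eq_or_eq_neg_of_abs_eq hv.abs_eq_one with h | h
      exacts [⟨1, by simp, by simp [h]⟩, ⟨-1, by simp, by simp [h]⟩]
    have hrow : (B *ᵥ v) j = (c j * σ : ℤ) := by
      rw [mulVec_apply_of_isUpperTriangular hB.isUpperTriangular hv.eq_zero, hB.diag_eq, hvσ]
      push_cast; rfl
    have hcσ : |c j * σ| = |c j| := by rw [abs_mul, hσ, mul_one]
    obtain ⟨δ, hδ, hδ1⟩ := exists_int_abs_le_abs_sub_eq_one (n := c j * σ) (by
      rw [← abs_pos, hcσ]; linarith [hB.two_le_abs j])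
    refine ⟨δ, hcσ ▸ hδ, fun h => absurd h (lt_irrefl _), fun _ => ?_,
      fun h => absurd h (lt_irrefl _)⟩
    rw [hrow]
    exact_mod_cast hδ1
  · have hrow : (B *ᵥ v) j = 0 := by
      rw [mulVec_apply_of_isUpperTriangular hB.isUpperTriangular
        fun l hl => hv.eq_zero l (hj.trans hl), hv.eq_zero j hj, mul_zero]
    exact ⟨0, by simpa using (by norm_num : (1 : ℤ) ≤ 2).trans (hB.two_le_abs j),
      fun h => absurd h hj.asymm, fun h => absurd h hj.ne', fun _ => by simp [hrow]⟩

theorem single_mem_sub_of_isIFSAttractor (hB : IsNearDiagonal B c) {T : Set (ι → ℝ)}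
    (hT : IsIFSAttractor (translateInvMap B) (digitBox c) T) (i : ι) :
    Pi.single i 1 ∈ T - T := by
  have hbdd : Bornology.IsBounded {v : ι → ℝ | IsPivotVector i v} :=
    isBounded_iff_forall_norm_le.2 ⟨1, fun v hv => hv.norm_le_one⟩
  refine hT.subset_sub (L := B⁻¹.mulVecLin.toAddMonoidHom) hB.lipschitzWith_inv_mulVec (by bound)
    hbdd (fun v hv => ?_) (isPivotVector_single i)
  obtain ⟨δ, hδ, hpivot⟩ := hB.exists_isPivotVector_sub hv
  obtain ⟨k, hk, l, hl, rfl⟩ := exists_mem_digitBox_sub_eq hδ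
  refine ⟨_, hpivot, k, hk, l, hl, ?_⟩
  have hcancel : B *ᵥ v - (fun j => ((k - l) j : ℝ)) +
      ((fun j => (k j : ℝ)) - fun j => (l j : ℝ)) = B *ᵥ v := by
    ext j
    simp
  rw [hcancel]
  simp [nonsing_inv_mul _ hB.isUnit_det]

theorem isConnected_of_isIFSAttractor (hB : IsNearDiagonal B c) {T : Set (ι → ℝ)}
    (hT : IsIFSAttractor (translateInvMap B) (digitBox c) T) : IsConnected T := by
  refine hT.isConnected (by bound) (fun k _ => hB.lipschitzWith_translateInvMap k)
    hB.zero_mem_digitBox fun k hk => ?_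
  induction le_iff_reflTransGen_covBy.1 hk.1 with
  | refl => exact .refl
  | @tail k l hchain hkl ih =>
    have hk' : k ∈ digitBox c := ⟨le_iff_reflTransGen_covBy.2 hchain, hkl.le.trans hk.2⟩
    refine (ih hk').tail ⟨hk', hk, ?_⟩
    obtain ⟨i, rfl⟩ := exists_eq_add_single_of_covBy hkl
    refine image_inter_image_nonempty_of_sub_mem_sub (fun x => B⁻¹ *ᵥ x) ?_
    convert hB.single_mem_sub_of_isIFSAttractor hT i using 1
    ext j
    simp [Pi.single_apply]

theorem exists_isIFSAttractor (hB : IsNearDiagonal B c) :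
    ∃ T, IsIFSAttractor (translateInvMap B) (digitBox c) T :=
  _root_.exists_isIFSAttractor (Set.finite_Icc _ _) ⟨0, hB.zero_mem_digitBox⟩ (by bound)
    fun k _ => hB.lipschitzWith_translateInvMap k

theorem eq_of_isIFSAttractor (hB : IsNearDiagonal B c) {D : Set (ι → ℤ)} {T T' : Set (ι → ℝ)}
    (hT : IsIFSAttractor (translateInvMap B) D T) (hT' : IsIFSAttractor (translateInvMap B) D T') :
    T = T' :=
  hT.eq (by bound) (fun k _ => hB.lipschitzWith_translateInvMap k) hT'

end IsNearDiagonal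

end NearDiagonal

section Triangularization

open Matrix Polynomial Module

theorem aeval_comp_eq_comp_aeval {R M N : Type*} [CommSemiring R] [AddCommMonoid M] [Module R M]
    [AddCommMonoid N] [Module R N] {f : End R M} {g : End R N} {φ : M →ₗ[R] N}
    (h : g ∘ₗ φ = φ ∘ₗ f) (p : R[X]) : aeval g p ∘ₗ φ = φ ∘ₗ aeval f p := by
  induction p using Polynomial.induction_on' with
  | add p q hp hq => rw [map_add, map_add, LinearMap.add_comp, LinearMap.comp_add, hp, hq]
  | monomial n a =>
    rw [aeval_monomial, aeval_monomial, ← Algebra.smul_def, ← Algebra.smul_def,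
      LinearMap.smul_comp, LinearMap.comp_smul, Module.End.commute_pow_left_of_commute h]

theorem isUpperTriangular_toMatrix_sumQuot {R M : Type*} [CommRing R] [AddCommGroup M]
    [Module R M] {W : Submodule R M} {f : End R M} (hW : W ≤ W.comap f) {k n : ℕ}
    {b : Basis (Fin k) R W} {c : Basis (Fin n) R (M ⧸ W)}
    (hb : (LinearMap.toMatrix b b (f.restrict hW)).IsUpperTriangular)
    (hc : (LinearMap.toMatrix c c (W.mapQ W f hW)).IsUpperTriangular) :
    let d := (b.sumQuot c).reindex finSumFinEquiv
    (LinearMap.toMatrix d d f).IsUpperTriangular := by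
  intro d i j hji
  rw [LinearMap.toMatrix_apply, Basis.reindex_apply, Basis.repr_reindex_apply]
  induction i using Fin.addCases with
  | left i =>
    induction j using Fin.addCases with
    | left j =>
      have hij := hb (show j < i from hji)
      rw [LinearMap.toMatrix_apply, ← Basis.sumQuot_repr_inl b c] at hij
      rwa [finSumFinEquiv_symm_apply_castAdd, finSumFinEquiv_symm_apply_castAdd, Basis.sumQuot_inl]
    | right j => exact absurd hji (Fin.lt_def.2 ((Fin.castAdd_lt n i).trans_le (by simp))).not_gt
  | right i =>
    rw [finSumFinEquiv_symm_apply_natAdd, Basis.sumQuot_repr_inr]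
    induction j using Fin.addCases with
    | left j =>
      have hmem : W.mkQ (f (b j)) = 0 := (Submodule.Quotient.mk_eq_zero W).2 (hW (b j).2)
      rw [finSumFinEquiv_symm_apply_castAdd, Basis.sumQuot_inl, hmem, map_zero, Finsupp.zero_apply]
    | right j =>
      have hij := hc (show j < i by simpa using hji)
      rw [LinearMap.toMatrix_apply, ← Basis.sumQuot_inr b c, W.mapQ_apply] at hij
      rwa [finSumFinEquiv_symm_apply_natAdd]

theorem exists_basis_isUpperTriangular_toMatrix {R : Type*} [CommRing R] [IsDomain R]
    [IsPrincipalIdealRing R] (s : List R) {M : Type*} [AddCommGroup M] [Module R M]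
    [Module.Free R M] [Module.Finite R M] (f : End R M)
    (hf : aeval f (s.map fun a => X - C a).prod = 0) :
    ∃ (n : ℕ) (b : Basis (Fin n) R M), (LinearMap.toMatrix b b f).IsUpperTriangular := by
  induction s generalizing M with
  | nil =>
    have : Subsingleton M := (subsingleton_iff_forall_eq 0).2 fun x => by
      simpa using LinearMap.congr_fun hf x
    exact ⟨0, Basis.empty M, fun i => i.elim0⟩
  | cons a s ih =>
    let g : End R M := f - algebraMap R (End R M) a
    have hcomm : g ∘ₗ f = f ∘ₗ g :=
      ((Commute.refl f).sub_right (Algebra.commutes a f).symm).eq.symm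
    have hW : LinearMap.ker g ≤ (LinearMap.ker g).comap f := fun x hx => by
      rw [Submodule.mem_comap, LinearMap.mem_ker, ← LinearMap.comp_apply, hcomm,
        LinearMap.comp_apply, hx, map_zero]
    have : Module.Free R (M ⧸ LinearMap.ker g) := .of_equiv g.quotKerEquivRange.symm
    have hquot : aeval ((LinearMap.ker g).mapQ _ f hW) (s.map fun a => X - C a).prod = 0 := by
      refine LinearMap.cancel_right (LinearMap.ker g).mkQ_surjective |>.1 ?_
      rw [aeval_comp_eq_comp_aeval (Submodule.mapQ_mkQ ..), LinearMap.zero_comp]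
      ext x
      rw [List.map_cons, List.prod_cons, map_mul] at hf
      simpa [g] using LinearMap.congr_fun hf x
    obtain ⟨n, c, hc⟩ := ih _ hquot
    refine ⟨_, _, isUpperTriangular_toMatrix_sumQuot hW (b := finBasis R _) ?_ hc⟩
    have : f.restrict (p := LinearMap.ker g) (q := LinearMap.ker g) hW = algebraMap R _ a := by
      ext x
      exact sub_eq_zero.1 x.2
    rw [this, LinearMap.toMatrix_algebraMap]
    exact blockTriangular_algebraMap _

theorem exists_units_conj_isUpperTriangular {R : Type*} [CommRing R] [IsDomain R]
    [IsPrincipalIdealRing R] {m : ℕ} (A : Matrix (Fin m) (Fin m) R) (hA : A.charpoly.Splits) :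
    ∃ (P : (Matrix (Fin m) (Fin m) R)ˣ) (M : Matrix (Fin m) (Fin m) R),
      M.IsUpperTriangular ∧ A = P.val * M * P⁻¹.val := by
  obtain ⟨s, hs⟩ := Quot.exists_rep A.charpoly.roots
  have haeval : aeval A.toLin' (s.map fun a => X - C a).prod = 0 := by
    rw [← LinearMap.aeval_self_charpoly A.toLin', charpoly_toLin',
      hA.eq_prod_roots_of_monic A.charpoly_monic, ← hs]
    simp
  obtain ⟨n, b, hb⟩ := exists_basis_isUpperTriangular_toMatrix s A.toLin' haeval
  let e := Pi.basisFun R (Fin m)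
  obtain rfl : n = m := by simpa using Fintype.card_congr (b.indexEquiv e)
  refine ⟨⟨e.toMatrix b, b.toMatrix e, e.toMatrix_mul_toMatrix_flip b,
    b.toMatrix_mul_toMatrix_flip e⟩, _, hb, ?_⟩
  rw [Units.inv_mk, basis_toMatrix_mul_linearMap_toMatrix_mul_basis_toMatrix,
    LinearMap.toMatrix_eq_toMatrix', LinearMap.toMatrix'_toLin']

end Triangularization

section IntegerMatrix

open Matrix Polynomial Finset

theorem isEigenvalueOf_iff_isRoot_charpoly {m : ℕ} {A : Matrix (Fin m) (Fin m) ℤ} {μ : ℂ} :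
    IsEigenvalueOf A μ ↔ (A.charpoly.map (Int.castRingHom ℂ)).IsRoot μ := by
  rw [IsEigenvalueOf, Module.End.hasEigenvalue_iff_isRoot_charpoly, charpoly_toLin',
    ← charpoly_map]
  rfl

theorem splits_charpoly_of_isEigenvalueOf_rat {m : ℕ} {A : Matrix (Fin m) (Fin m) ℤ}
    (hrat : ∀ μ : ℂ, IsEigenvalueOf A μ → ∃ r : ℚ, μ = (r : ℂ)) : A.charpoly.Splits := by
  refine Splits.of_splits_map_of_injective (i := Int.castRingHom ℂ) Int.cast_injective
    (IsAlgClosed.splits _) fun μ hμ => ?_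
  have hroot := isRoot_of_mem_roots hμ
  obtain ⟨r, rfl⟩ := hrat μ (isEigenvalueOf_iff_isRoot_charpoly.2 hroot)
  have hint : IsIntegral ℤ (algebraMap ℚ ℂ r) :=
    ⟨A.charpoly, A.charpoly_monic, by rwa [IsRoot.def, eval_map] at hroot⟩
  rw [isIntegral_algebraMap_iff (algebraMap ℚ ℂ).injective] at hint
  obtain ⟨a, rfl⟩ := IsIntegrallyClosed.isIntegral_iff.1 hint
  exact ⟨a, by simp⟩

theorem isEigenvalueOf_units_conj {m : ℕ} {M : Matrix (Fin m) (Fin m) ℤ}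
    (P : (Matrix (Fin m) (Fin m) ℤ)ˣ) {μ : ℂ} :
    IsEigenvalueOf (P.val * M * P⁻¹.val) μ ↔ IsEigenvalueOf M μ := by
  rw [isEigenvalueOf_iff_isRoot_charpoly, isEigenvalueOf_iff_isRoot_charpoly, coe_units_inv,
    charpoly_units_conj]

theorem isEigenvalueOf_diag {m : ℕ} {M : Matrix (Fin m) (Fin m) ℤ} (hM : M.IsUpperTriangular)
    (i : Fin m) : IsEigenvalueOf M (M i i) := by
  rw [isEigenvalueOf_iff_isRoot_charpoly, charpoly_of_isUpperTriangular M hM, Polynomial.map_prod,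
    isRoot_prod]
  exact ⟨i, mem_univ i, by simp⟩

theorem IsDilationMatrix.two_le_abs_diag {m : ℕ} {M : Matrix (Fin m) (Fin m) ℤ}
    (hdil : IsDilationMatrix M) (hM : M.IsUpperTriangular) (i : Fin m) : 2 ≤ |M i i| := by
  have h : 1 < ‖((M i i : ℤ) : ℂ)‖ := hdil _ (isEigenvalueOf_diag hM i)
  rw [Complex.norm_intCast] at h
  exact_mod_cast h

theorem isDilationMatrix_units_conj {m : ℕ} {M : Matrix (Fin m) (Fin m) ℤ}
    (P : (Matrix (Fin m) (Fin m) ℤ)ˣ) :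
    IsDilationMatrix (P.val * M * P⁻¹.val) ↔ IsDilationMatrix M :=
  forall_congr' fun _ => by rw [isEigenvalueOf_units_conj]

end IntegerMatrix

section DigitSet

open Matrix Finset

theorem isDigitSet_of_injOn_of_ncard_eq {m : ℕ} {A : Matrix (Fin m) (Fin m) ℤ}
    {D : Set (Fin m → ℤ)} (hA : A.det ≠ 0) (hinj : D.InjOn (LinearMap.range A.mulVecLin).mkQ)
    (hcard : D.ncard = A.det.natAbs) : IsDigitSet A D := by
  have hinjA : Function.Injective A.mulVecLin :=
    (injective_iff_map_eq_zero _).2 fun _ => eq_zero_of_mulVec_eq_zero hA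
  have hindex : Nat.card ((Fin m → ℤ) ⧸ LinearMap.range A.mulVecLin) = A.det.natAbs := by
    rw [← Submodule.natAbs_det_equiv _ (LinearEquiv.ofInjective _ hinjA), ← LinearMap.det_toLin']
    rfl
  have : Finite ((Fin m → ℤ) ⧸ LinearMap.range A.mulVecLin) :=
    Nat.finite_of_card_ne_zero (hindex ▸ Int.natAbs_ne_zero.2 hA)
  refine ⟨Set.mapsTo_univ _ _, hinj, ?_⟩
  refine (Set.eq_of_subset_of_ncard_le (Set.subset_univ _) ?_).ge
  rw [hinj.ncard_image, hcard, Set.ncard_univ, hindex]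

theorem ncard_digitBox {ι : Type*} [Fintype ι] (c : ι → ℤ) :
    (digitBox c).ncard = (∏ i, c i).natAbs := by
  classical
  rw [digitBox, ← Finset.coe_Icc, Set.ncard_coe_finset, Pi.card_Icc]
  rw [← Int.natAbsHom_apply, map_prod]
  refine Finset.prod_congr rfl fun i _ => ?_
  rw [Pi.zero_apply, Int.card_Icc, sub_add_cancel, sub_zero, Int.abs_eq_natAbs, Int.toNat_natCast,
    Int.natAbsHom_apply]

theorem abs_sub_lt_of_mem_digitBox {ι : Type*} {c k l : ι → ℤ} (hk : k ∈ digitBox c)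
    (hl : l ∈ digitBox c) (i : ι) : |k i - l i| < |c i| :=
  abs_sub_lt_of_nonneg_of_lt (hk.1 i) (Int.lt_of_le_sub_one (hk.2 i)) (hl.1 i)
    (Int.lt_of_le_sub_one (hl.2 i))

theorem eq_of_mul_sub_eq_mulVec {ι : Type*} [Fintype ι] [LinearOrder ι] {M : Matrix ι ι ℤ}
    (hM : M.IsUpperTriangular) (hdiag : ∀ i, M i i ≠ 0) {r : ι → ℤ}
    (hr : ∀ i, IsCoprime (r i) (M i i)) {k l w : ι → ℤ} (hk : k ∈ digitBox M.diag)
    (hl : l ∈ digitBox M.diag) (hw : r * (k - l) = M *ᵥ w) : k = l := by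
  have key : ∀ i, w i = 0 ∧ k i = l i := by
    intro i
    induction i using WellFoundedGT.induction with
    | ind i ih =>
      have hrow := congrFun hw i
      rw [mulVec_apply_of_isUpperTriangular hM fun j hj => (ih j hj).1, Pi.mul_apply,
        Pi.sub_apply] at hrow
      have hdvd : M i i ∣ k i - l i := (hr i).symm.dvd_of_dvd_mul_left ⟨w i, hrow⟩
      have hkl : k i - l i = 0 :=
        Int.eq_zero_of_abs_lt_dvd ((abs_dvd _ _).2 hdvd) (abs_sub_lt_of_mem_digitBox hk hl i)
      rw [hkl, mul_zero] at hrow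
      exact ⟨(mul_eq_zero.1 hrow.symm).resolve_left (hdiag i), sub_eq_zero.1 hkl⟩
  exact funext fun i => (key i).2

theorem isDigitSet_image_digitBox {m : ℕ} {M : Matrix (Fin m) (Fin m) ℤ}
    (hM : M.IsUpperTriangular) (hdiag : ∀ i, M i i ≠ 0) {r : Fin m → ℤ}
    (hr : ∀ i, IsCoprime (r i) (M i i)) (P : (Matrix (Fin m) (Fin m) ℤ)ˣ) :
    IsDigitSet (P.val * M * P⁻¹.val) ((fun k => P.val *ᵥ (r * k)) '' digitBox M.diag) := by
  have hdet : M.det = ∏ i, M i i := det_of_isUpperTriangular hM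
  have hinj : (digitBox M.diag).InjOn
      ((LinearMap.range (P.val * M * P⁻¹.val).mulVecLin).mkQ ∘ fun k => P.val *ᵥ (r * k)) := by
    intro k hk l hl hkl
    obtain ⟨w, hw⟩ := (Submodule.Quotient.eq _).1 hkl
    refine eq_of_mul_sub_eq_mulVec hM hdiag hr hk hl (w := P⁻¹.val *ᵥ w) ?_
    calc r * (k - l) = P⁻¹.val *ᵥ (P.val *ᵥ (r * k) - P.val *ᵥ (r * l)) := by
          rw [← mulVec_sub, ← mul_sub, mulVec_mulVec, P.inv_mul, one_mulVec]
      _ = M *ᵥ (P⁻¹.val *ᵥ w) := by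
          rw [← hw, mulVecLin_apply, mulVec_mulVec, mulVec_mulVec, ← Matrix.mul_assoc,
            ← Matrix.mul_assoc, P.inv_mul, Matrix.one_mul]
  refine isDigitSet_of_injOn_of_ncard_eq ?_ hinj.image_of_comp ?_
  · rw [det_units_conj, hdet]
    exact prod_ne_zero_iff.2 fun i _ => hdiag i
  · rw [det_units_conj, hdet, hinj.of_comp.ncard_image, ncard_digitBox]
    rfl

end DigitSet

section Rescaling

open Matrix Finset

theorem exists_lt_isCoprime (a : ℤ) {d : ℤ} (hd : d ≠ 0) : ∃ b, a < b ∧ IsCoprime b d := by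
  refine ⟨1 + |a| * |d|, ?_, 1, -(|a| * d.sign), ?_⟩
  · have := le_mul_of_one_le_right (abs_nonneg a) (Int.one_le_abs hd)
    linarith [le_abs_self a]
  · rw [one_mul, neg_mul, mul_assoc, Int.sign_mul_self_eq_abs, add_neg_cancel_right]

theorem norm_conj_diagonal_pow_apply_le {m : ℕ} {M : Matrix (Fin m) (Fin m) ℝ}
    (hM : M.IsUpperTriangular) {b : ℝ} (hb : 1 ≤ b) {i j : Fin m} (hij : j ≠ i) :
    ‖(b ^ i.rev.val)⁻¹ * M i j * b ^ j.rev.val‖ ≤ ‖M i j‖ / b := by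
  have hb0 : 0 < b := zero_lt_one.trans_le hb
  rcases hij.lt_or_gt with hji | hij
  · simp [hM hji]
  · have hpow : b ^ j.rev.val * b ≤ b ^ i.rev.val := by
      rw [← pow_succ]
      exact pow_le_pow_right₀ hb (Fin.rev_lt_rev.2 hij)
    rw [norm_mul, norm_mul, norm_inv, norm_pow, norm_pow, Real.norm_of_nonneg hb0.le,
      le_div_iff₀ hb0]
    calc (b ^ i.rev.val)⁻¹ * ‖M i j‖ * b ^ j.rev.val * b
        = ‖M i j‖ * ((b ^ i.rev.val)⁻¹ * (b ^ j.rev.val * b)) := by ring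
      _ ≤ ‖M i j‖ * 1 := by gcongr; exact inv_mul_le_one_of_le₀ hpow (by positivity)
      _ = ‖M i j‖ := mul_one _

theorem exists_isNearDiagonal_conj_diagonal {m : ℕ} {M : Matrix (Fin m) (Fin m) ℤ}
    (hM : M.IsUpperTriangular) (hdiag : ∀ i, 2 ≤ |M i i|) :
    ∃ r : Fin m → ℤ, (∀ i, r i ≠ 0) ∧ (∀ i, IsCoprime (r i) (M i i)) ∧
      IsNearDiagonal (diagonal (fun i => (r i : ℝ)⁻¹) * M.map (Int.cast : ℤ → ℝ) *
        diagonal (fun i => (r i : ℝ))) M.diag := by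
  have hne : ∏ i, M i i ≠ 0 := prod_ne_zero_iff.2 fun i _ =>
    abs_pos.1 (zero_lt_two.trans_le (hdiag i))
  obtain ⟨b, hsum, hcop⟩ := exists_lt_isCoprime (2 * ∑ i, ∑ j, |M i j|) hne
  have hb : 0 < b := hsum.trans_le' (by positivity)
  refine ⟨fun i => b ^ i.rev.val, fun i => pow_ne_zero _ hb.ne',
    fun i => (hcop.of_isCoprime_of_dvd_right (dvd_prod_of_mem _ (mem_univ i))).pow_left,
    fun i j hji => ?_, fun i => ?_, hdiag, fun i => ?_⟩
  · simp [hM hji]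
  · have hbi : (b : ℝ) ^ i.rev.val ≠ 0 := pow_ne_zero _ (Int.cast_ne_zero.2 hb.ne')
    simp only [diagonal_mul, mul_diagonal, Int.cast_pow, map_apply, diag_apply]
    field_simp
  · have hrow : 2 * ∑ j, |M i j| < b := by
      have := single_le_sum (f := fun i => ∑ j, |M i j|) (fun _ _ => by positivity) (mem_univ i)
      linarith
    have hMreal : (M.map (Int.cast : ℤ → ℝ)).IsUpperTriangular := hM.map (Int.castRingHom ℝ)
    have hb1 : (1 : ℝ) ≤ b := by exact_mod_cast hb
    calc ∑ j ∈ univ.erase i, _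
        ≤ ∑ j ∈ univ.erase i, ‖(M.map (Int.cast : ℤ → ℝ)) i j‖ / b := by
          refine sum_le_sum fun j hj => ?_
          simpa using norm_conj_diagonal_pow_apply_le hMreal hb1 (ne_of_mem_erase hj)
      _ ≤ ∑ j, |(M i j : ℝ)| / b :=
        sum_le_sum_of_subset_of_nonneg (erase_subset _ _) fun _ _ _ => by positivity
      _ < 1 / 2 := by
        rw [← sum_div, div_lt_div_iff₀ (by positivity) two_pos]
        rw [mul_comm, one_mul]
        exact_mod_cast hrow

theorem inv_mul_eq_mul_inv_of_mul_eq {ι R : Type*} [Fintype ι] [DecidableEq ι] [CommRing R]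
    {A B Q : Matrix ι ι R} (hQ : IsUnit Q.det) (h : A * Q = Q * B) : A⁻¹ * Q = Q * B⁻¹ := by
  have hA : A = Q * B * Q⁻¹ := by rw [← h, mul_nonsing_inv_cancel_right _ _ hQ]
  rw [hA, Matrix.mul_inv_rev, Matrix.mul_inv_rev, nonsing_inv_nonsing_inv _ hQ,
    ← Matrix.mul_assoc, nonsing_inv_mul_cancel_right _ _ hQ]

theorem conj_mul_mul_eq_mul_mul_conj {R : Type*} [Monoid R] {p p' s s' : R} (hp : p' * p = 1)
    (hs : s * s' = 1) (x : R) : p * x * p' * (p * s) = p * s * (s' * x * s) := by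
  calc p * x * p' * (p * s) = p * x * (p' * p) * s := by simp only [mul_assoc]
    _ = p * (s * s') * x * s := by rw [hp, hs, mul_one, mul_one]
    _ = p * s * (s' * x * s) := by simp only [mul_assoc]

theorem translateInvMap_mulVec {ι : Type*} [Fintype ι] [DecidableEq ι] {A B Q : Matrix ι ι ℝ}
    (hQ : IsUnit Q.det) (h : A * Q = Q * B) {d k : ι → ℤ}
    (hd : (fun i => (d i : ℝ)) = Q *ᵥ fun i => (k i : ℝ)) (x : ι → ℝ) :
    translateInvMap A d (Q *ᵥ x) = Q *ᵥ translateInvMap B k x := by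
  rw [translateInvMap, translateInvMap, hd, ← mulVec_add, mulVec_mulVec, mulVec_mulVec,
    inv_mul_eq_mul_inv_of_mul_eq hQ h]

theorem isAttractor_iff_isIFSAttractor {m : ℕ} {A : Matrix (Fin m) (Fin m) ℤ}
    {D : Set (Fin m → ℤ)} {T : Set (Fin m → ℝ)} : IsAttractor A D T ↔
      IsIFSAttractor (translateInvMap (A.map (Int.cast : ℤ → ℝ))) D T :=
  ⟨fun ⟨h₁, h₂, h₃⟩ => ⟨h₁, h₂, h₃⟩, fun ⟨h₁, h₂, h₃⟩ => ⟨h₁, h₂, h₃⟩⟩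

theorem exists_homeomorph_isAttractor_image_iff {m : ℕ} (P : (Matrix (Fin m) (Fin m) ℤ)ˣ)
    (M : Matrix (Fin m) (Fin m) ℤ) {r : Fin m → ℤ} (hr : ∀ i, r i ≠ 0) :
    ∃ e : (Fin m → ℝ) ≃ₜ (Fin m → ℝ), ∀ D T,
      IsAttractor (P.val * M * P⁻¹.val) ((fun k => P.val *ᵥ (r * k)) '' D) (e '' T) ↔
        IsIFSAttractor (translateInvMap (diagonal (fun i => (r i : ℝ)⁻¹) *
          M.map (Int.cast : ℤ → ℝ) * diagonal (fun i => (r i : ℝ)))) D T := by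
  let cast : Matrix (Fin m) (Fin m) ℤ →+* Matrix (Fin m) (Fin m) ℝ := (Int.castRingHom ℝ).mapMatrix
  let Q := cast P * diagonal fun i => (r i : ℝ)
  have hP : cast P.val * cast P⁻¹.val = 1 := by rw [← map_mul, P.mul_inv, map_one]
  have hQ : IsUnit Q.det := by
    rw [det_mul, det_diagonal]
    refine (isUnit_det_of_right_inverse hP).mul (prod_ne_zero_iff.2 fun i _ => ?_).isUnit
    exact_mod_cast hr i
  let e := (Q.toLinearEquiv' (invertibleOfIsUnitDet Q hQ)).toContinuousLinearEquiv.toHomeomorph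
  refine ⟨e, fun D T => ?_⟩
  rw [isAttractor_iff_isIFSAttractor]
  refine isIFSAttractor_image_iff e _ fun k x => translateInvMap_mulVec hQ ?_ ?_ x
  · have hPinv : cast P⁻¹.val * cast P.val = 1 := by rw [← map_mul, P.inv_mul, map_one]
    have hdiag : diagonal (fun i => (r i : ℝ)) * diagonal (fun i => (r i : ℝ)⁻¹) = 1 := by
      rw [diagonal_mul_diagonal, ← diagonal_one]
      exact congrArg diagonal <| funext fun i => mul_inv_cancel₀ (Int.cast_ne_zero.2 (hr i))
    change cast (P.val * M * P⁻¹.val) * Q = _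
    rw [map_mul, map_mul]
    exact conj_mul_mul_eq_mul_mul_conj hPinv hdiag (cast M)
  · rw [← mulVec_mulVec]
    ext i
    simp [mulVec, dotProduct, cast, diagonal_apply]

end Rescaling

theorem mainTheorem1 (m : ℕ) (A : Matrix (Fin m) (Fin m) ℤ) (hA : IsDilationMatrix A)
    (hrat : ∀ μ : ℂ, IsEigenvalueOf A μ → ∃ r : ℚ, μ = (r : ℂ)) :
    ∃ D : Set (Fin m → ℤ), IsDigitSet A D ∧
      ∃ T : Set (Fin m → ℝ), IsAttractor A D T ∧ (∀ K, IsAttractor A D K → K = T) ∧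
        IsConnected T := by
  obtain ⟨P, M, hM, rfl⟩ :=
    exists_units_conj_isUpperTriangular A (splits_charpoly_of_isEigenvalueOf_rat hrat)
  have hdiag : ∀ i, 2 ≤ |M i i| := ((isDilationMatrix_units_conj P).1 hA).two_le_abs_diag hM
  obtain ⟨r, hr, hcop, hB⟩ := exists_isNearDiagonal_conj_diagonal hM hdiag
  obtain ⟨T, hT⟩ := hB.exists_isIFSAttractor
  obtain ⟨e, he⟩ := exists_homeomorph_isAttractor_image_iff P M hr
  refine ⟨_, isDigitSet_image_digitBox hM (fun i => ?_) hcop P, e '' T, (he _ T).2 hT,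
    fun K hK => ?_, (hB.isConnected_of_isIFSAttractor hT).image e e.continuous.continuousOn⟩
  · exact abs_pos.1 (zero_lt_two.trans_le (hdiag i))
  · rw [← e.image_preimage K] at hK ⊢
    rw [hB.eq_of_isIFSAttractor ((he _ _).1 hK) hT]
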